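/- Work in the Baire space $\omega^\omega$ with the product topology, and let $\mathcal B$ be the family of its Borel subsets. A tree is a set $T\subseteq\omega^{<\omega}$ closed under initial segments; $[T]=\{x\in\omega^\omega:\ x\upharpoonright n\in T\text{ for all }n\}$ is its body, and $\mathrm{succ}_T(t)=\{a\in\omega:\ t^\frown a\in T\}$ for $t\in T$. A nonempty tree $T$ is - a Sacks tree ($T\in\mathbb S$) if every $s\in T$ has an extension $t\supseteq s$ in $T$ with $|\mathrm{succ}_T(t)|\ge 2$; - a Miller tree ($T\in\mathbb M$) if every $s\in T$ has an extension $t\supseteq s$ in $T$ with $|\mathrm{succ}_T(t)|=\aleph_0$; - a Laver tree ($T\in\mathbb L$) if it has a stem, i.e. a node $\tau\in T$ with $|\mathrm{succ}_T(\tau)|>1$ and $|\mathrm{succ}_T(s)|=1$ for every $s\subsetneq\tau$, and $|\mathrm{succ}_T(t)|=\aleph_0$ for every $t\in T$ with $t\supseteq\tau$. For a family $\mathbb T$ of trees let $t_0$ be the family of all $A\subseteq\omega^\omega$ such that for every $P\in\mathbb T$ there is $Q\in\mathbb T$ with $Q\subseteq P$ and $[Q]\cap A=\emptyset$; for $\mathbb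 T=\mathbb S,\mathbb M,\mathbb L$ it is denoted $s_0,m_0,l_0$ respectively. A set $B\subseteq\omega^\omega$ is $\mathbb T$-Bernstein if $B\cap[T]\ne\emptyset$ and $[T]\setminus B\neq\emptyset$ for every $T\in\mathbb T$. For a family $\mathcal I$ of subsets of $\omega^\omega$, a set $A$ is $\mathcal I$-nonmeasurable if it does not belong to the $\sigma$-algebra $\sigma(\mathcal B\cup\mathcal I)$ generated by $\mathcal B\cup\mathcal I$, and completely $\mathcal I$-nonmeasurable if $A\cap C$ is $\mathcal I$-nonmeasurable for every Borel set $C\notin\mathcal I$. **Corollary.** Let $(\mathbb T,t_0)\in\{(\mathbb S,s_0),(\mathbb M,m_0),(\mathbb L,l_0)\}$. Then a set $B\subseteq\omega^\omega$ is $\mathbb T$-Bernstein if and only if it is completely $(t_0\cap\mathcal B)$-nonmeasurable. -/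

import Mathlib

namespace TreeIdeal

open Descriptive
open scoped MeasureTheory

/-- The set of immediate successors `{a | t⌢a ∈ T}` of a node `t` in a tree `T` on `ℕ`. -/
def succs (T : tree ℕ) (t : List ℕ) : Set ℕ := {a | t ++ [a] ∈ T}

/-- The restriction `x ↾ n` of an infinite sequence, as the finite sequence
`[x 0, …, x (n - 1)]`. -/
def restrict (x : ℕ → ℕ) (n : ℕ) : List ℕ := (List.range n).map x

/-- The body `[T]`: the set of all infinite branches of `T`. -/
def body (T : tree ℕ) : Set (ℕ → ℕ) := {x | ∀ n, restrict x n ∈ T}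

/-- `τ` is the stem of `T`: a node with more than one successor, all of whose proper initial
segments have exactly one successor. -/
def IsStem (T : tree ℕ) (τ : List ℕ) : Prop :=
  τ ∈ T ∧ (∀ s, s <+: τ → s ≠ τ → (succs T s).encard = 1) ∧ 1 < (succs T τ).encard

/-- Sacks (perfect) trees: nonempty trees in which every node extends to a splitting node. -/
def sacks : Set (tree ℕ) :=
  {T | [] ∈ T ∧ ∀ s ∈ T, ∃ t ∈ T, s <+: t ∧ 2 ≤ (succs T t).encard}

/-- Miller (superperfect) trees: nonempty trees in which every node extends to a node with
infinitely (equivalently, as these are sets of naturals, `ℵ₀`) many successors. -/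
def miller : Set (tree ℕ) :=
  {T | [] ∈ T ∧ ∀ s ∈ T, ∃ t ∈ T, s <+: t ∧ (succs T t).Infinite}

/-- Laver trees: trees with a stem such that every node extending the stem has infinitely many
successors. -/
def laver : Set (tree ℕ) :=
  {T | ∃ τ, IsStem T τ ∧ ∀ t ∈ T, τ <+: t → (succs T t).Infinite}

/-- The tree ideal `t₀` of a family `𝕋` of trees. -/
def treeIdeal (𝕋 : Set (tree ℕ)) : Set (Set (ℕ → ℕ)) :=
  {A | ∀ P ∈ 𝕋, ∃ Q ∈ 𝕋, Q ≤ P ∧ body Q ∩ A = ∅}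

/-- `B` is `𝕋`-Bernstein: it meets the body of every tree in `𝕋`, and so does its complement. -/
def IsBernstein (𝕋 : Set (tree ℕ)) (B : Set (ℕ → ℕ)) : Prop :=
  ∀ T ∈ 𝕋, (B ∩ body T).Nonempty ∧ (body T \ B).Nonempty

/-- The family of Borel subsets of a topological space. -/
def borelSets (X : Type*) [TopologicalSpace X] : Set (Set X) := {B | MeasurableSet[borel X] B}

/-- `A` is `I`-nonmeasurable: it is not in the σ-algebra generated by the Borel sets and `I`. -/
def IsNonmeasurable {X : Type*} [TopologicalSpace X] (I : Set (Set X)) (A : Set X) : Prop :=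
  ¬ MeasurableSet[MeasurableSpace.generateFrom (borelSets X ∪ I)] A

/-- `A` is completely `I`-nonmeasurable: its trace on each Borel set outside `I` is
`I`-nonmeasurable. -/
def IsCompletelyNonmeasurable {X : Type*} [TopologicalSpace X] (I : Set (Set X))
    (A : Set X) : Prop :=
  ∀ B ∈ borelSets X, B ∉ I → IsNonmeasurable I (A ∩ B)

end TreeIdeal

namespace TreeIdeal

open Descriptive

/-! ### Restrictions, bodies and subtrees -/

/-! Since `I ∩ borelSets` adds nothing to the Borel σ-algebra, nonmeasurable here just means
non-Borel. If `B` misses or contains some `[T]`, then `B ∩ [T]` is empty or `[T]`, hence Borel,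
although the closed set `[T]` is not in `t₀`. Conversely, everything rests on Borel sets being
decided: below each tree lies one whose body is inside or outside the given set
(`decided_of_borel`). If `C` is Borel and not in `t₀`, some `[Q] ⊆ C`; were `B ∩ C` Borel, a tree
below `Q` would decide it, so its body would lie inside `B` or miss `B`, and `B` would not be
Bernstein.

Decided sets form a σ-algebra containing the open sets. Countable unions need fusion
(`Stemmed.fusion`), and for Laver trees fusion must not move stems; `pureAvoidance_laver` supplies
this. -/

lemma length_restrict (x : ℕ → ℕ) (n : ℕ) : (restrict x n).length = n := by
  simp [restrict]

lemma restrict_succ (x : ℕ → ℕ) (n : ℕ) : restrict x (n + 1) = restrict x n ++ [x n] := by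
  simp [restrict, List.range_succ]

lemma restrict_prefix (x : ℕ → ℕ) {m n : ℕ} (h : m ≤ n) : restrict x m <+: restrict x n := by
  induction n, h using Nat.le_induction with
  | base => exact List.prefix_rfl
  | succ n _ ih => exact ih.trans (by rw [restrict_succ]; exact List.prefix_append _ _)

lemma body_mono {Q P : tree ℕ} (h : Q ≤ P) : body Q ⊆ body P := fun _ hx n => h (hx n)

lemma mem_body_of_frequently {T : tree ℕ} {x : ℕ → ℕ} (h : ∀ n, ∃ m ≥ n, restrict x m ∈ T) :
    x ∈ body T := fun n => by
  obtain ⟨m, hm, hx⟩ := h n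
  exact Tree.mem_of_prefix (restrict_prefix x hm) hx

lemma isClosed_body (T : tree ℕ) : IsClosed (body T) := by
  have : body T = ⋂ n, {x | restrict x n ∈ T} := by ext; simp [body]
  rw [this]
  refine isClosed_iInter fun n => ?_
  have hc : Continuous fun x : ℕ → ℕ => fun i : Fin n => x i :=
    continuous_pi fun i => continuous_apply _
  have hS : {x : ℕ → ℕ | restrict x n ∈ T} =
      (fun x : ℕ → ℕ => fun i : Fin n => x i) ⁻¹' {f | List.ofFn f ∈ T} := by
    ext x
    have : restrict x n = List.ofFn fun i : Fin n => x i := by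
      apply List.ext_getElem <;> simp [restrict]
    simp [this]
  rw [hS]
  exact (isClosed_discrete _).preimage hc

lemma exists_cylinder_subset {U : Set (ℕ → ℕ)} (hU : IsOpen U) {x : ℕ → ℕ} (hx : x ∈ U) :
    ∃ n, ∀ y, restrict y n = restrict x n → y ∈ U := by
  obtain ⟨I, u, hI, hs⟩ := isOpen_pi_iff.1 hU x hx
  refine ⟨I.sup id + 1, fun y hy => hs fun i hi => ?_⟩
  have hlt : i < I.sup id + 1 := Nat.lt_succ_of_le (Finset.le_sup (f := id) hi)
  have : y i = x i := List.map_inj_left.1 hy i (List.mem_range.2 hlt)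
  rw [this]
  exact (hI i hi).2

/-- A tree all of whose nodes can be extended has a branch. -/
lemma body_nonempty_of_succs {T : tree ℕ} (h0 : [] ∈ T) (h : ∀ s ∈ T, (succs T s).Nonempty) :
    (body T).Nonempty := by
  choose! f hf using h
  let L : ℕ → List ℕ := fun n => Nat.rec [] (fun _ s => s ++ [f s]) n
  have hL : ∀ n, restrict (fun k => f (L k)) n = L n := by
    intro n
    induction n with
    | zero => rfl
    | succ n ih => rw [restrict_succ, ih]
  have hT : ∀ n, L n ∈ T := by
    intro n
    induction n with
    | zero => exact h0
    | succ n ih => exact hf _ ih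
  exact ⟨_, fun n => by rw [hL]; exact hT n⟩

/-- Two finite sequences are comparable if one of them is an initial segment of the other. -/
def Comparable (s t : List ℕ) : Prop := s <+: t ∨ t <+: s

lemma Comparable.symm {s t : List ℕ} (h : Comparable s t) : Comparable t s := Or.symm h

lemma Comparable.of_prefix_left {r s t : List ℕ} (h : Comparable s t) (hr : r <+: s) :
    Comparable r t :=
  h.elim (fun h => Or.inl (hr.trans h)) fun h => List.prefix_or_prefix_of_prefix hr h

lemma Comparable.of_prefix {r s r' t : List ℕ} (h : Comparable s t) (hr : r <+: s)
    (hr' : r' <+: t) : Comparable r r' :=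
  ((h.of_prefix_left hr).symm.of_prefix_left hr').symm

lemma Comparable.prefix_of_length_le {s t : List ℕ} (h : Comparable s t)
    (hl : s.length ≤ t.length) : s <+: t :=
  h.elim id fun h => by rw [h.eq_of_length_le hl]

lemma Comparable.eq_of_append_singleton {s : List ℕ} {a b : ℕ}
    (h : Comparable (s ++ [a]) (s ++ [b])) : a = b := by
  have := (h.prefix_of_length_le (by simp)).eq_of_length (by simp)
  simpa using this

lemma exists_append_singleton_prefix {s t : List ℕ} (h : s <+: t) (hne : s ≠ t) :
    ∃ a, s ++ [a] <+: t := by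
  obtain ⟨r, rfl⟩ := h
  cases r with
  | nil => simp at hne
  | cons a r => exact ⟨a, by simp⟩

/-- The subtree of the nodes of `T` comparable with `u`. -/
def treeAt (T : tree ℕ) (u : List ℕ) : tree ℕ :=
  ⟨{s | s ∈ T ∧ Comparable s u}, fun _ _ h =>
    ⟨Tree.mem_of_append h.1, h.2.of_prefix_left (List.prefix_append _ _)⟩⟩

lemma treeAt_le (T : tree ℕ) (u : List ℕ) : treeAt T u ≤ T := fun _ h => h.1

lemma succs_mono {Q P : tree ℕ} (h : Q ≤ P) (s : List ℕ) : succs Q s ⊆ succs P s :=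
  fun _ ha => h ha

lemma succs_treeAt {T : tree ℕ} {u s : List ℕ} (h : u <+: s) :
    succs (treeAt T u) s = succs T s :=
  Set.Subset.antisymm (succs_mono (treeAt_le T u) s)
    fun _ ha => ⟨ha, Or.inr (h.trans (List.prefix_append _ _))⟩

lemma restrict_of_mem_body_treeAt {T : tree ℕ} {u : List ℕ} {x : ℕ → ℕ}
    (hx : x ∈ body (treeAt T u)) : restrict x u.length = u := by
  have h : Comparable _ u := (hx u.length).2
  exact (h.prefix_of_length_le (length_restrict _ _).le).eq_of_length (length_restrict _ _)

/-! ### Trees with a splitting stem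

The three families of trees are treated together: `N` says which sets of successors count as
splitting, and `c` says whether every node above the stem has to split. -/

/-- `u` is an admissible extension of `s`: any extension if `c` fails, and only `s` if `c` holds. -/
def Ext (c : Prop) (s u : List ℕ) : Prop := s <+: u ∧ (c → s = u)

lemma Ext.trans {c : Prop} {s t u : List ℕ} (h : Ext c s t) (h' : Ext c t u) : Ext c s u :=
  ⟨h.1.trans h'.1, fun hc => (h.2 hc).trans (h'.2 hc)⟩

/-- `T` is a tree with splitting stem `τ` in which every node above `τ` has an admissible
extension that splits. -/
structure Stemmed (N : Set ℕ → Prop) (c : Prop) (T : tree ℕ) (τ : List ℕ) : Prop where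
  mem : τ ∈ T
  comparable : ∀ s ∈ T, Comparable s τ
  split : N (succs T τ)
  ext : ∀ s ∈ T, τ <+: s → ∃ u ∈ T, Ext c s u ∧ N (succs T u)

section

variable {N : Set ℕ → Prop} {c : Prop}

lemma stemmed_treeAt {T : tree ℕ} {u : List ℕ} (hu : u ∈ T) (hN : N (succs T u))
    (h : ∀ s ∈ T, u <+: s → ∃ v ∈ T, Ext c s v ∧ N (succs T v)) : Stemmed N c (treeAt T u) u where
  mem := ⟨hu, Or.inl List.prefix_rfl⟩
  comparable s hs := hs.2
  split := by rwa [succs_treeAt List.prefix_rfl]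
  ext s hs hus := by
    obtain ⟨v, hv, hsv, hNv⟩ := h s hs.1 hus
    exact ⟨v, ⟨hv, Or.inr (hus.trans hsv.1)⟩, hsv, by rwa [succs_treeAt (hus.trans hsv.1)]⟩

lemma Stemmed.treeAt {T : tree ℕ} {τ u : List ℕ} (hT : Stemmed N c T τ) (hu : u ∈ T)
    (hτ : τ <+: u) (hN : N (succs T u)) : Stemmed N c (treeAt T u) u :=
  stemmed_treeAt hu hN fun s hs hus => hT.ext s hs (hτ.trans hus)

lemma Stemmed.nil_mem {T : tree ℕ} {τ : List ℕ} (hT : Stemmed N c T τ) : [] ∈ T :=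
  Tree.mem_of_prefix List.nil_prefix hT.mem

/-- If `u` were properly below `τ`, two distinct successors of `u` in `Q` would both be initial
segments of `τ`. -/
lemma Stemmed.stem_prefix (hN : ∀ S, N S → S.Nontrivial) {F Q : tree ℕ} {τ u : List ℕ}
    (hF : Stemmed N c F τ) (hQ : Stemmed N c Q u) (h : Q ≤ F) : τ <+: u := by
  rcases hF.comparable u (h hQ.mem) with hu | hu
  · by_contra hne
    have hlt : u.length < τ.length := by
      by_contra hl
      exact hne (by rw [hu.eq_of_length_le (not_lt.1 hl)])
    obtain ⟨a, ha, b, hb, hab⟩ := hN _ hQ.split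
    have key : ∀ a ∈ succs Q u, u ++ [a] <+: τ := fun a ha =>
      (hF.comparable _ (h ha)).prefix_of_length_le (by simpa using hlt)
    exact hab (Comparable.eq_of_append_singleton
      (List.prefix_or_prefix_of_prefix (key a ha) (key b hb)))
  · exact hu

lemma Stemmed.body_nonempty (hN : ∀ S, N S → S.Nontrivial) {T : tree ℕ} {τ : List ℕ}
    (hT : Stemmed N c T τ) : (body T).Nonempty := by
  refine body_nonempty_of_succs hT.nil_mem fun s hs => ?_
  have key : ∀ u ∈ T, s <+: u → N (succs T u) → (succs T s).Nonempty := by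
    intro u hu hsu hNu
    by_cases hne : s = u
    · exact hne ▸ (hN _ hNu).nonempty
    · obtain ⟨a, ha⟩ := exists_append_singleton_prefix hsu hne
      exact ⟨a, Tree.mem_of_prefix ha hu⟩
  rcases hT.comparable s hs with h | h
  · exact key τ hT.mem h hT.split
  · obtain ⟨u, hu, hsu, hNu⟩ := hT.ext s hs h
    exact key u hu hsu.1 hNu

/-! ### Fusion -/

/-- The pairs (tree, stem) at level `n` of the fusion scheme which starts with `(P, τ)` and replaces
`(F, t)` by the pairs `(nT n F t a, nS n F t a)`, where `a` is a successor of `t` in `F`. -/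
inductive Reach (nT : ℕ → tree ℕ → List ℕ → ℕ → tree ℕ) (nS : ℕ → tree ℕ → List ℕ → ℕ → List ℕ)
    (P : tree ℕ) (τ : List ℕ) : ℕ → tree ℕ → List ℕ → Prop
  | base : Reach nT nS P τ 0 P τ
  | step {n : ℕ} {F : tree ℕ} {t : List ℕ} {a : ℕ} : Reach nT nS P τ n F t → a ∈ succs F t →
      Reach nT nS P τ (n + 1) (nT n F t a) (nS n F t a)

/-- If every stemmed subtree of `P` can be shrunk, above each successor of its stem, to one
satisfying `D n`, then there is a stemmed subtree of `P` with the same stem each of whose branches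
is, for every `n`, a branch of some tree satisfying `D n`. -/
theorem Stemmed.fusion {P : tree ℕ} {τ : List ℕ} (hP : Stemmed N c P τ)
    (hmono : ∀ S S', S ⊆ S' → N S → N S') (hne : ∀ S, N S → S.Nonempty) (D : ℕ → tree ℕ → Prop)
    (hstep : ∀ n F t, Stemmed N c F t → F ≤ P → ∀ a ∈ succs F t,
      ∃ F' ≤ F, ∃ u, Stemmed N c F' u ∧ Ext c (t ++ [a]) u ∧ D n F') :
    ∃ Q ≤ P, Stemmed N c Q τ ∧ ∀ x ∈ body Q, ∀ n, ∃ F, D n F ∧ x ∈ body F := by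
  -- Made total, with `(F, t)` as junk value, so that `choose` gives functions defining `Reach`.
  have hstep' : ∀ n F t a, ∃ F' u, Stemmed N c F t → F ≤ P → a ∈ succs F t →
      F' ≤ F ∧ Stemmed N c F' u ∧ Ext c (t ++ [a]) u ∧ D n F' := by
    intro n F t a
    by_cases h : Stemmed N c F t ∧ F ≤ P ∧ a ∈ succs F t
    · obtain ⟨F', h1, u, h2⟩ := hstep n F t h.1 h.2.1 a h.2.2
      exact ⟨F', u, fun _ _ _ => ⟨h1, h2⟩⟩
    · exact ⟨F, t, fun h1 h2 h3 => (h ⟨h1, h2, h3⟩).elim⟩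
  choose nT nS hn using hstep'
  let R := Reach nT nS P τ
  have hinv : ∀ {n F t}, R n F t → Stemmed N c F t ∧ F ≤ P := by
    intro n F t h
    induction h with
    | base => exact ⟨hP, le_rfl⟩
    | @step n _ _ _ _ ha ih =>
      have := hn n _ _ _ ih.1 ih.2 ha
      exact ⟨this.2.1, this.1.trans ih.2⟩
  have hnext : ∀ {n F t a}, R n F t → a ∈ succs F t →
      nT n F t a ≤ F ∧ Stemmed N c (nT n F t a) (nS n F t a) ∧
        Ext c (t ++ [a]) (nS n F t a) ∧ D n (nT n F t a) :=
    fun h ha => hn _ _ _ _ (hinv h).1 (hinv h).2 ha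
  -- At each level, distinct pairs have incomparable stems: the first difference is the choice of
  -- successor.
  have huniq : ∀ {n F t F' t'}, R n F t → R n F' t' → Comparable t t' → F = F' ∧ t = t' := by
    intro n F t F' t' h
    induction h generalizing F' t' with
    | base => intro h' _; cases h'; exact ⟨rfl, rfl⟩
    | step h ha ih =>
      intro h' hc
      cases h' with
      | step h' ha' =>
        have e := (hnext h ha).2.2.1.1
        have e' := (hnext h' ha').2.2.1.1
        obtain ⟨rfl, rfl⟩ := ih h' (hc.of_prefix ((List.prefix_append _ _).trans e)
          ((List.prefix_append _ _).trans e'))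
        obtain rfl := (hc.of_prefix e e').eq_of_append_singleton
        exact ⟨rfl, rfl⟩
  have hlen : ∀ {n F t}, R n F t → τ.length + n ≤ t.length ∧ (c → t.length = τ.length + n) := by
    intro n F t h
    induction h with
    | base => simp
    | step h ha ih =>
      have e := (hnext h ha).2.2.1
      constructor
      · have := e.1.length_le
        simp only [List.length_append, List.length_singleton] at this
        omega
      · intro hc
        rw [← e.2 hc]
        simp [ih.2 hc, add_assoc]
  have hup : ∀ {n F t}, R n F t → ∀ k, ∃ F' t', R (n + k) F' t' ∧ t <+: t' := by
    intro n F t h k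
    induction k with
    | zero => exact ⟨F, t, h, List.prefix_rfl⟩
    | succ k ih =>
      obtain ⟨F', t', h', ht⟩ := ih
      obtain ⟨a, ha⟩ := hne _ (hinv h').1.split
      exact ⟨_, _, Reach.step h' ha,
        ht.trans ((List.prefix_append _ _).trans (hnext h' ha).2.2.1.1)⟩
  have hdown : ∀ {n F t}, R n F t → ∀ k ≤ n, ∃ F' t', R k F' t' ∧ F ≤ F' := by
    intro n F t h
    induction h with
    | base => intro k hk; obtain rfl := Nat.le_zero.1 hk; exact ⟨_, _, Reach.base, le_rfl⟩
    | step h ha ih =>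
      intro k hk
      rcases Nat.of_le_succ hk with hk | rfl
      · obtain ⟨F', t', h', hle⟩ := ih k hk
        exact ⟨F', t', h', (hnext h ha).1.trans hle⟩
      · exact ⟨_, _, Reach.step h ha, le_rfl⟩
  -- The fusion: intersect over the levels the union of all trees at that level.
  let Q : tree ℕ := ⟨{s | ∀ n, ∃ F t, R n F t ∧ s ∈ F}, fun s a h n => by
    obtain ⟨F, t, hF, hs⟩ := h n
    exact ⟨F, t, hF, Tree.mem_of_append hs⟩⟩
  have hQmem : ∀ {s}, s ∈ Q ↔ ∀ n, ∃ F t, R n F t ∧ s ∈ F := Iff.rfl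
  have hstem : ∀ {n F t}, R n F t → t ∈ Q := by
    intro n F t h
    rw [hQmem]
    intro m
    rcases le_total m n with hm | hm
    · obtain ⟨F', t', h', hle⟩ := hdown h m hm
      exact ⟨F', t', h', hle (hinv h).1.mem⟩
    · obtain ⟨k, rfl⟩ := Nat.exists_eq_add_of_le hm
      obtain ⟨F', t', h', hle⟩ := hup h k
      exact ⟨F', t', h', Tree.mem_of_prefix hle (hinv h').1.mem⟩
  have hsucc : ∀ {n F t}, R n F t → succs F t ⊆ succs Q t := fun h a ha =>
    Tree.mem_of_prefix (hnext h ha).2.2.1.1 (hstem (Reach.step h ha))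
  have hQP : Q ≤ P := fun s hs => by
    obtain ⟨F, t, hF, hsF⟩ := hQmem.1 hs 0
    exact (hinv hF).2 hsF
  refine ⟨Q, hQP, ⟨hstem Reach.base, fun s hs => hP.comparable s (hQP hs),
    hmono _ _ (hsucc Reach.base) hP.split, fun s hs hτ => ?_⟩, fun x hx => ?_⟩
  -- At level `|s| - |τ|` stems have length at least `|s|`, and exactly `|s|` when `c` holds; so `t`
  -- extends `s` admissibly.
  · obtain ⟨F, t, hF, hsF⟩ := hQmem.1 hs (s.length - τ.length)
    have hl := hlen hF
    have hτl := hτ.length_le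
    have hst : s <+: t := ((hinv hF).1.comparable s hsF).prefix_of_length_le (by omega)
    exact ⟨t, hstem hF, ⟨hst, fun hc => hst.eq_of_length (by have := hl.2 hc; omega)⟩,
      hmono _ _ (hsucc hF) (hinv hF).1.split⟩
  · have hbr : ∀ n, ∃ F t, R n F t ∧ x ∈ body F := by
      intro n
      induction n with
      | zero => exact ⟨P, τ, Reach.base, body_mono hQP hx⟩
      | succ n ih =>
        obtain ⟨F, t, hF, hxF⟩ := ih
        have ht : restrict x t.length = t :=
          (((hinv hF).1.comparable _ (hxF t.length)).prefix_of_length_le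
            (length_restrict _ _).le).eq_of_length (length_restrict _ _)
        have hta : restrict x (t.length + 1) = t ++ [x t.length] := by rw [restrict_succ, ht]
        have ha : x t.length ∈ succs F t := by
          have := hxF (t.length + 1)
          rwa [hta] at this
        refine ⟨_, _, Reach.step hF ha, mem_body_of_frequently fun k =>
          ⟨max k (t.length + 1), le_max_left _ _, ?_⟩⟩
        have htm : t ++ [x t.length] <+: restrict x (max k (t.length + 1)) :=
          hta ▸ restrict_prefix x (le_max_right _ _)
        -- A restriction reaching past `t ++ [x t.length]` determines, by `huniq`, which tree of
        -- level `n + 1` contains it.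
        obtain ⟨_, _, hF', hm⟩ := hQmem.1 (hx (max k (t.length + 1))) (n + 1)
        cases hF' with
        | @step _ G s b hG hb =>
          have hm' := (hnext hG hb).2.1.comparable _ hm
          have hsb := (hnext hG hb).2.2.1.1
          obtain ⟨rfl, rfl⟩ := huniq hF hG (hm'.of_prefix
            ((List.prefix_append _ _).trans htm) ((List.prefix_append _ _).trans hsb))
          rw [(hm'.of_prefix htm hsb).eq_of_append_singleton]
          exact hm
    intro n
    obtain ⟨F, t, hF, hxF⟩ := hbr (n + 1)
    cases hF with
    | step h ha => exact ⟨_, (hnext h ha).2.2.2, hxF⟩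

/-! ### Sets decided by stemmed trees -/

/-- Below every stemmed tree there is one whose body is contained in `A` or disjoint from `A`. -/
def Decided (N : Set ℕ → Prop) (c : Prop) (A : Set (ℕ → ℕ)) : Prop :=
  ∀ P τ, Stemmed N c P τ → ∃ Q ≤ P, ∃ u, Stemmed N c Q u ∧ (body Q ⊆ A ∨ Disjoint (body Q) A)

/-- Below every stemmed subtree of `P` there is one whose body is disjoint from `A`. -/
def AvoidableBelow (N : Set ℕ → Prop) (c : Prop) (P : tree ℕ) (A : Set (ℕ → ℕ)) : Prop :=
  ∀ F τ, Stemmed N c F τ → F ≤ P → ∃ Q ≤ F, ∃ u, Stemmed N c Q u ∧ Disjoint (body Q) A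

/-- Sets which can be avoided can be avoided by trees with admissible stems. -/
def PureAvoidance (N : Set ℕ → Prop) (c : Prop) : Prop :=
  ∀ P A, AvoidableBelow N c P A → ∀ F τ, Stemmed N c F τ → F ≤ P →
    ∃ Q ≤ F, ∃ u, Stemmed N c Q u ∧ Ext c τ u ∧ Disjoint (body Q) A

lemma pureAvoidance_of_not (hN : ∀ S, N S → S.Nontrivial) (hc : ¬ c) : PureAvoidance N c := by
  intro P A h F τ hF hFP
  obtain ⟨Q, hQ, u, hu, hd⟩ := h F τ hF hFP
  exact ⟨Q, hQ, u, hu, ⟨hF.stem_prefix hN hu hQ, fun h => (hc h).elim⟩, hd⟩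

lemma decided_compl {A : Set (ℕ → ℕ)} (h : Decided N c A) : Decided N c Aᶜ := by
  intro P τ hP
  obtain ⟨Q, hQ, u, hu, h | h⟩ := h P τ hP
  · exact ⟨Q, hQ, u, hu, Or.inr (Set.disjoint_compl_right_iff_subset.2 h)⟩
  · exact ⟨Q, hQ, u, hu, Or.inl (Set.subset_compl_iff_disjoint_right.2 h)⟩

lemma decided_of_isOpen {U : Set (ℕ → ℕ)} (hU : IsOpen U) : Decided N c U := by
  intro P τ hP
  by_cases h : ∃ x ∈ body P, x ∈ U
  · obtain ⟨x, hxP, hxU⟩ := h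
    obtain ⟨n, hn⟩ := exists_cylinder_subset hU hxU
    have hτ : τ <+: restrict x (max n τ.length) :=
      (hP.comparable _ (hxP _)).symm.prefix_of_length_le (by simp [length_restrict])
    obtain ⟨u, hu, hxu, hNu⟩ := hP.ext _ (hxP _) hτ
    refine ⟨treeAt P u, treeAt_le _ _, u, hP.treeAt hu (hτ.trans hxu.1) hNu,
      Or.inl fun y hy => hn y ?_⟩
    have hxu' : restrict x n <+: u := (restrict_prefix x (le_max_left _ _)).trans hxu.1
    have hnu : n ≤ u.length := by simpa [length_restrict] using hxu'.length_le
    have hyu : restrict y n <+: u := by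
      have := restrict_prefix y hnu
      rwa [restrict_of_mem_body_treeAt hy] at this
    exact (List.prefix_of_prefix_length_le hyu hxu' (by simp [length_restrict])).eq_of_length
      (by simp [length_restrict])
  · exact ⟨P, le_rfl, τ, hP, Or.inr (Set.disjoint_left.2 fun x hx hxU => h ⟨x, hx, hxU⟩)⟩

/-- If no subtree has its body inside some `A n`, every `A n` is avoidable below `P`, and fusion
avoids `A n` at level `n`. Decidedness alone could lengthen stems inadmissibly, hence
`PureAvoidance`. -/
lemma decided_iUnion (hmono : ∀ S S', S ⊆ S' → N S → N S') (hN : ∀ S, N S → S.Nontrivial)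
    (hp : PureAvoidance N c) {A : ℕ → Set (ℕ → ℕ)} (hA : ∀ n, Decided N c (A n)) :
    Decided N c (⋃ n, A n) := by
  intro P τ hP
  by_cases h : ∃ n, ∃ Q ≤ P, ∃ u, Stemmed N c Q u ∧ body Q ⊆ A n
  · obtain ⟨n, Q, hQ, u, hu, hs⟩ := h
    exact ⟨Q, hQ, u, hu, Or.inl (hs.trans (Set.subset_iUnion A n))⟩
  · have hav : ∀ n, AvoidableBelow N c P (A n) := by
      intro n F t hF hFP
      obtain ⟨Q, hQ, u, hu, hs | hd⟩ := hA n F t hF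
      · exact (h ⟨n, Q, hQ.trans hFP, u, hu, hs⟩).elim
      · exact ⟨Q, hQ, u, hu, hd⟩
    obtain ⟨Q, hQ, hQτ, hD⟩ := hP.fusion hmono (fun S hS => (hN S hS).nonempty)
      (fun n F => Disjoint (body F) (A n)) fun n F t hF hFP a ha => by
        obtain ⟨u, hu, hau, hNu⟩ := hF.ext _ ha (List.prefix_append _ _)
        obtain ⟨Q, hQ, v, hv, huv, hd⟩ := hp P (A n) (hav n) _ u
          (hF.treeAt hu ((List.prefix_append _ _).trans hau.1) hNu) ((treeAt_le _ _).trans hFP)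
        exact ⟨Q, hQ.trans (treeAt_le _ _), v, hv, hau.trans huv, hd⟩
    refine ⟨Q, hQ, τ, hQτ, Or.inr (Set.disjoint_left.2 fun x hx hxA => ?_)⟩
    obtain ⟨n, hn⟩ := Set.mem_iUnion.1 hxA
    obtain ⟨F, hF, hxF⟩ := hD x hx n
    exact Set.disjoint_left.1 hF hxF hn

/-- Borel sets are decided by stemmed trees. -/
theorem decided_of_borel (hmono : ∀ S S', S ⊆ S' → N S → N S') (hN : ∀ S, N S → S.Nontrivial)
    (hp : PureAvoidance N c) {A : Set (ℕ → ℕ)} (hA : A ∈ borelSets (ℕ → ℕ)) : Decided N c A := by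
  refine MeasurableSpace.generateFrom_induction _ (fun s _ => Decided N c s)
    (fun t ht _ => decided_of_isOpen ht) ?_ (fun t _ => decided_compl)
    (fun s _ hs => decided_iUnion hmono hN hp hs) A hA
  exact decided_of_isOpen isOpen_empty

end

/-! ### Pure avoidance for Laver trees -/

/-- If infinitely many immediate successors of `s` are stems of Laver subtrees of `F` avoiding `A`,
then so is `s`. -/
lemma exists_stemmed_of_infinite_succs {F : tree ℕ} {A : Set (ℕ → ℕ)} {s : List ℕ}
    (h : {a | ∃ Q ≤ F, Stemmed Set.Infinite True Q (s ++ [a]) ∧ Disjoint (body Q) A}.Infinite) :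
    ∃ Q ≤ F, Stemmed Set.Infinite True Q s ∧ Disjoint (body Q) A := by
  set G := {a | ∃ Q ≤ F, Stemmed Set.Infinite True Q (s ++ [a]) ∧ Disjoint (body Q) A} with hG
  choose! q hqF hq hd using fun a (ha : a ∈ G) => ha
  let Q : tree ℕ := ⟨{t | ∃ a ∈ G, t ∈ q a}, fun _ _ ⟨a, ha, ht⟩ => ⟨a, ha, Tree.mem_of_append ht⟩⟩
  have hQ : ∀ {t}, t ∈ Q ↔ ∃ a ∈ G, t ∈ q a := Iff.rfl
  have hs : G ⊆ succs Q s := fun a ha => hQ.2 ⟨a, ha, (hq a ha).mem⟩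
  obtain ⟨a₀, ha₀⟩ := h.nonempty
  refine ⟨Q, fun t ⟨a, ha, ht⟩ => hqF a ha ht, ⟨Tree.mem_of_append (hs ha₀), ?_, h.mono hs, ?_⟩, ?_⟩
  · rintro t ⟨a, ha, ht⟩
    exact ((hq a ha).comparable t ht).symm.of_prefix_left (List.prefix_append _ _) |>.symm
  · rintro t ⟨a, ha, ht⟩ hst
    refine ⟨t, ⟨a, ha, ht⟩, ⟨List.prefix_rfl, fun _ => rfl⟩, ?_⟩
    by_cases hne : s = t
    · exact hne ▸ h.mono hs
    · obtain ⟨b, hb⟩ := exists_append_singleton_prefix hst hne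
      obtain rfl := (((hq a ha).comparable t ht).of_prefix_left hb).eq_of_append_singleton
      obtain ⟨u, -, htu, hu⟩ := (hq b ha).ext t ht hb
      rw [← htu.2 trivial] at hu
      exact hu.mono fun d hd => hQ.2 ⟨b, ha, hd⟩
  · refine Set.disjoint_left.2 fun x hx hxA => ?_
    -- The value of `x` at `s.length` singles out one `q a`, so `x` cannot wander between them.
    have hcomp : ∀ {m a}, a ∈ G → restrict x m ∈ q a → s.length + 1 ≤ m →
        restrict x (s.length + 1) = s ++ [a] := by
      intro m a ha hm hl
      exact ((((hq a ha).comparable _ hm).of_prefix_left (restrict_prefix x hl)).prefix_of_length_le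
        (by simp [length_restrict])).eq_of_length (by simp [length_restrict])
    obtain ⟨a, ha, hxa⟩ := hQ.1 (hx (s.length + 1))
    refine Set.disjoint_left.1 (hd a ha) (mem_body_of_frequently fun k =>
      ⟨max k (s.length + 1), le_max_left _ _, ?_⟩) hxA
    obtain ⟨b, hb, hxb⟩ := hQ.1 (hx (max k (s.length + 1)))
    have hab : s ++ [a] = s ++ [b] :=
      (hcomp ha hxa le_rfl).symm.trans (hcomp hb hxb (le_max_right _ _))
    obtain rfl : a = b := by simpa using hab
    exact hxb

/-- A node that is not good has only finitely many good successors. If `τ` is not good, deleting all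
good nodes above `τ`, with their extensions, leaves a Laver tree `R` with stem `τ`. Avoidability
gives a subtree of `R` avoiding `A`; its stem is a good node of `R`, a contradiction. -/
lemma pureAvoidance_laver : PureAvoidance Set.Infinite True := by
  intro P A h F τ hF hFP
  let Good : List ℕ → Prop := fun s => ∃ Q ≤ F, Stemmed Set.Infinite True Q s ∧ Disjoint (body Q) A
  by_cases hgood : Good τ
  · obtain ⟨Q, hQ, hQτ, hd⟩ := hgood
    exact ⟨Q, hQ, τ, hQτ, ⟨List.prefix_rfl, fun _ => rfl⟩, hd⟩
  let R : tree ℕ := ⟨{s | s ∈ F ∧ ∀ v, τ <+: v → v <+: s → ¬ Good v}, fun s a hs =>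
    ⟨Tree.mem_of_append hs.1, fun v hv hvs => hs.2 v hv (hvs.trans (List.prefix_append _ _))⟩⟩
  have hR : ∀ {s}, s ∈ R ↔ s ∈ F ∧ ∀ v, τ <+: v → v <+: s → ¬ Good v := Iff.rfl
  have hRF : R ≤ F := fun s hs => hs.1
  have hτR : τ ∈ R := hR.2 ⟨hF.mem, fun v hv hv' => by
    rwa [← hv.eq_of_length_le hv'.length_le]⟩
  have hsplit : ∀ s ∈ R, τ <+: s → (succs R s).Infinite := by
    intro s hs hτs
    obtain ⟨u, -, hsu, hu⟩ := hF.ext s hs.1 hτs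
    rw [← hsu.2 trivial] at hu
    have hfin : {a | Good (s ++ [a])}.Finite := by
      by_contra hinf
      exact hs.2 s hτs List.prefix_rfl (exists_stemmed_of_infinite_succs hinf)
    refine (hu.sdiff hfin).mono fun a ha => hR.2 ⟨ha.1, fun v hv hvs => ?_⟩
    rcases List.prefix_concat_iff.1 hvs with rfl | hvs
    · exact ha.2
    · exact hs.2 v hv hvs
  have hRτ : Stemmed Set.Infinite True R τ :=
    ⟨hτR, fun s hs => hF.comparable s hs.1, hsplit τ hτR List.prefix_rfl, fun s hs hτs =>
      ⟨s, hs, ⟨List.prefix_rfl, fun _ => rfl⟩, hsplit s hs hτs⟩⟩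
  obtain ⟨Q, hQ, u, hu, hd⟩ := h R τ hRτ (hRF.trans hFP)
  have hτu := hRτ.stem_prefix (fun _ h => h.nontrivial) hu hQ
  exact ((hQ hu.mem).2 u hτu List.prefix_rfl ⟨Q, hQ.trans hRF, hu, hd⟩).elim

/-! ### Bernstein sets -/

/-- `𝕋` is generated by stemmed trees. -/
structure GeneratedByStemmed (N : Set ℕ → Prop) (c : Prop) (𝕋 : Set (tree ℕ)) : Prop where
  mem : ∀ T τ, Stemmed N c T τ → T ∈ 𝕋
  exists_le : ∀ T ∈ 𝕋, ∃ T' ≤ T, ∃ τ, Stemmed N c T' τ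

lemma generatedByStemmed_sacks : GeneratedByStemmed Set.Nontrivial False sacks where
  mem T τ hT := by
    refine ⟨hT.nil_mem, fun s hs => ?_⟩
    have key : ∀ S : Set ℕ, S.Nontrivial → 2 ≤ S.encard := fun S hS => by
      have := Order.add_one_le_of_lt (Set.one_lt_encard_iff_nontrivial.2 hS)
      rwa [one_add_one_eq_two] at this
    rcases hT.comparable s hs with h | h
    · exact ⟨τ, hT.mem, h, key _ hT.split⟩
    · obtain ⟨u, hu, hsu, hNu⟩ := hT.ext s hs h
      exact ⟨u, hu, hsu.1, key _ hNu⟩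
  exists_le T hT := by
    have key : ∀ S : Set ℕ, 2 ≤ S.encard → S.Nontrivial := fun S hS =>
      Set.one_lt_encard_iff_nontrivial.1 (lt_of_lt_of_le (by norm_num) hS)
    obtain ⟨h0, hT⟩ := hT
    obtain ⟨u, hu, -, hNu⟩ := hT [] h0
    refine ⟨treeAt T u, treeAt_le _ _, u, stemmed_treeAt hu (key _ hNu) fun s hs _ => ?_⟩
    obtain ⟨v, hv, hsv, hNv⟩ := hT s hs
    exact ⟨v, hv, ⟨hsv, False.elim⟩, key _ hNv⟩

lemma generatedByStemmed_miller : GeneratedByStemmed Set.Infinite False miller where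
  mem T τ hT := by
    refine ⟨hT.nil_mem, fun s hs => ?_⟩
    rcases hT.comparable s hs with h | h
    · exact ⟨τ, hT.mem, h, hT.split⟩
    · obtain ⟨u, hu, hsu, hNu⟩ := hT.ext s hs h
      exact ⟨u, hu, hsu.1, hNu⟩
  exists_le T hT := by
    obtain ⟨h0, hT⟩ := hT
    obtain ⟨u, hu, -, hNu⟩ := hT [] h0
    refine ⟨treeAt T u, treeAt_le _ _, u, stemmed_treeAt hu hNu fun s hs _ => ?_⟩
    obtain ⟨v, hv, hsv, hNv⟩ := hT s hs
    exact ⟨v, hv, ⟨hsv, False.elim⟩, hNv⟩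

lemma generatedByStemmed_laver : GeneratedByStemmed Set.Infinite True laver where
  mem T τ hT := by
    refine ⟨τ, ⟨hT.mem, fun s hs hne => ?_,
      Set.one_lt_encard_iff_nontrivial.2 hT.split.nontrivial⟩, fun t ht hτt => ?_⟩
    · obtain ⟨a, ha⟩ := exists_append_singleton_prefix hs hne
      refine Set.encard_eq_one.2 ⟨a, Set.Subset.antisymm (fun b hb => ?_) ?_⟩
      · exact ((hT.comparable _ hb).symm.of_prefix_left ha).symm.eq_of_append_singleton
      · rintro _ rfl
        exact Tree.mem_of_prefix ha hT.mem
    · obtain ⟨u, -, htu, hu⟩ := hT.ext t ht hτt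
      rwa [← htu.2 trivial] at hu
  exists_le T hT := by
    obtain ⟨τ, hτ, hT⟩ := hT
    exact ⟨treeAt T τ, treeAt_le _ _, τ, stemmed_treeAt hτ.1 (hT τ hτ.1 List.prefix_rfl)
      fun s hs hτs => ⟨s, hs, ⟨List.prefix_rfl, fun _ => rfl⟩, hT s hs hτs⟩⟩

lemma isNonmeasurable_inter_borelSets {X : Type*} [TopologicalSpace X] (I : Set (Set X))
    (A : Set X) : IsNonmeasurable (I ∩ borelSets X) A ↔ A ∉ borelSets X := by
  rw [IsNonmeasurable, Set.union_eq_self_of_subset_right Set.inter_subset_right]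
  have : MeasurableSpace.generateFrom (borelSets X) = borel X :=
    @MeasurableSpace.generateFrom_measurableSet X (borel X)
  rw [this]
  rfl

theorem isBernstein_iff {N : Set ℕ → Prop} {c : Prop} {𝕋 : Set (tree ℕ)}
    (hmono : ∀ S S', S ⊆ S' → N S → N S') (hN : ∀ S, N S → S.Nontrivial)
    (hp : PureAvoidance N c) (h𝕋 : GeneratedByStemmed N c 𝕋) (B : Set (ℕ → ℕ)) :
    IsBernstein 𝕋 B ↔ IsCompletelyNonmeasurable (treeIdeal 𝕋 ∩ borelSets (ℕ → ℕ)) B := by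
  have hdec : ∀ C ∈ borelSets (ℕ → ℕ), ∀ P ∈ 𝕋, ∃ Q ∈ 𝕋, Q ≤ P ∧
      (body Q ⊆ C ∨ Disjoint (body Q) C) := by
    intro C hC P hP
    obtain ⟨P', hP', τ, hτ⟩ := h𝕋.exists_le P hP
    obtain ⟨Q, hQ, u, hu, h⟩ := decided_of_borel hmono hN hp hC P' τ hτ
    exact ⟨Q, h𝕋.mem Q u hu, hQ.trans hP', h⟩
  have hbody : ∀ T, body T ∈ borelSets (ℕ → ℕ) := fun T => by
    have h := (MeasurableSpace.measurableSet_generateFrom (isClosed_body T).isOpen_compl).compl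
    rwa [compl_compl] at h
  constructor
  · intro hB C hC hCI
    rw [isNonmeasurable_inter_borelSets]
    intro hBC
    have hCt : C ∉ treeIdeal 𝕋 := fun h => hCI ⟨h, hC⟩
    simp only [treeIdeal, Set.mem_ofPred_eq, not_forall] at hCt
    obtain ⟨P, hP, hPC⟩ := hCt
    obtain ⟨Q, hQ, hQP, hs | hd⟩ := hdec C hC P hP
    -- Inside `C`, deciding `B ∩ C` amounts to deciding `B`.
    · obtain ⟨Q', hQ', hQQ', hs' | hd'⟩ := hdec _ hBC Q hQ
      · obtain ⟨x, hx, hxB⟩ := (hB Q' hQ').2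
        exact hxB (hs' hx).1
      · obtain ⟨x, hxB, hx⟩ := (hB Q' hQ').1
        exact Set.disjoint_left.1 hd' hx ⟨hxB, hs (body_mono hQQ' hx)⟩
    · exact hPC ⟨Q, hQ, hQP, hd.inter_eq⟩
  · intro hB T hT
    have hTI : body T ∉ treeIdeal 𝕋 ∩ borelSets (ℕ → ℕ) := by
      rintro ⟨h, -⟩
      obtain ⟨Q, hQ, hQT, hd⟩ := h T hT
      obtain ⟨Q', hQ', u, hu⟩ := h𝕋.exists_le Q hQ
      obtain ⟨x, hx⟩ := hu.body_nonempty hN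
      have hxQ := body_mono hQ' hx
      exact (hd ▸ (⟨hxQ, body_mono hQT hxQ⟩ : x ∈ body Q ∩ body T) : x ∈ (∅ : Set _))
    have hBT := (isNonmeasurable_inter_borelSets _ _).1 (hB _ (hbody T) hTI)
    constructor
    · by_contra h
      rw [Set.not_nonempty_iff_eq_empty] at h
      exact hBT (h ▸ @MeasurableSet.empty _ (borel _))
    · by_contra h
      rw [Set.not_nonempty_iff_eq_empty, Set.sdiff_eq_empty] at h
      exact hBT ((Set.inter_eq_right.2 h).symm ▸ hbody T)

end TreeIdeal

theorem mainTheorem9 (𝕋 : Set (Descriptive.tree ℕ))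
    (h𝕋 : 𝕋 = TreeIdeal.sacks ∨ 𝕋 = TreeIdeal.miller ∨ 𝕋 = TreeIdeal.laver)
    (B : Set (ℕ → ℕ)) :
    TreeIdeal.IsBernstein 𝕋 B ↔
      TreeIdeal.IsCompletelyNonmeasurable
        (TreeIdeal.treeIdeal 𝕋 ∩ TreeIdeal.borelSets (ℕ → ℕ)) B := by
  rcases h𝕋 with rfl | rfl | rfl
  · exact TreeIdeal.isBernstein_iff (fun _ _ h hS => hS.mono h) (fun _ h => h)
      (TreeIdeal.pureAvoidance_of_not (fun _ h => h) not_false)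
      TreeIdeal.generatedByStemmed_sacks B
  · exact TreeIdeal.isBernstein_iff (fun _ _ h hS => hS.mono h) (fun _ h => h.nontrivial)
      (TreeIdeal.pureAvoidance_of_not (fun _ h => h.nontrivial) not_false)
      TreeIdeal.generatedByStemmed_miller B
  · exact TreeIdeal.isBernstein_iff (fun _ _ h hS => hS.mono h) (fun _ h => h.nontrivial)
      TreeIdeal.pureAvoidance_laver TreeIdeal.generatedByStemmed_laver B
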